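/- For $p\in(0,1)$ let $(X_i)_{i\ge 1}$ be the Markov chain with states $0,1$, transition matrix $$\begin{pmatrix}p_{00}&p_{01}\\p_{10}&p_{11}\end{pmatrix}=\begin{pmatrix}p&1-p\\1&0\end{pmatrix}$$ and initial probabilities $\mathrm{Prob}(X_1=0)=\frac{1}{2-p}$, $\mathrm{Prob}(X_1=1)=\frac{1-p}{2-p}$. For $\beta_0,\beta_1\in(0,1)$ let the Markov geometric measure $\mu_{\beta_0,\beta_1,p}$ be the Borel probability measure on $\mathbb{R}$ that is the distribution of the random series $$S=\sum_{i=1}^{\infty}X_i\,\beta_1^{\hat X_i}\beta_0^{\,i-\hat X_i},\qquad \hat X_i=\sum_{k=1}^{i}X_k .$$ For a Borel probability measure $\mu$ on $\mathbb{R}$ put $\dim_H\mu=\inf\{\dim_H A : A\subseteq\mathbb{R}\text{ Borel},\ \mu(A)=1\}$, where $\dim_H A$ is the Hausdorff dimension of $A$. **Theorem.** For all $\beta_0,\beta_1,p\in(0,1)$ with $\beta_0\,\beta_1^{1-p}<p^p(1-p)^{1-p}$, the measure $\mu_{\beta_0,\beta_1,p}$ is singular with respect to Lebesgue measure (there is a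 Borel set $B$ of Lebesgue measure zero with $\mu_{\beta_0,\beta_1,p}(B)=1$), and $$\dim_H\mu_{\beta_0,\beta_1,p}\le\frac{p\log p+(1-p)\log(1-p)}{\log\beta_0+(1-p)\log\beta_1}.$$ -/

import Mathlib

open MeasureTheory ProbabilityTheory

namespace MarkovGeometric

noncomputable section

/-- The probability measure on a finite state space given by a probability vector. -/
def vecMeasure {ι : Type*} [Fintype ι] [MeasurableSpace ι] (v : stdSimplex ℝ ι) : Measure ι :=
  ∑ i, ENNReal.ofReal (v.1 i) • Measure.dirac i

instance {ι : Type*} [Fintype ι] [MeasurableSpace ι] (v : stdSimplex ℝ ι) :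
    IsProbabilityMeasure (vecMeasure v) := by
  constructor
  simp only [vecMeasure, Measure.coe_finsetSum, Finset.sum_apply, Measure.smul_apply,
    measure_univ, smul_eq_mul, mul_one]
  rw [← ENNReal.ofReal_sum_of_nonneg fun i _ => v.2.1 i, v.2.2, ENNReal.ofReal_one]

/-- One step of the Markov chain with transition probabilities `M i j`, as a kernel from the path
up to time `n` to the state at time `n + 1`; it depends on the path only through its last state. -/
def stepKernel (M : Fin 2 → stdSimplex ℝ (Fin 2)) (n : ℕ) :
    Kernel (Π _ : Finset.Iic n, Fin 2) (Fin 2) :=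
  (Kernel.ofFunOfCountable fun i => vecMeasure (M i)).comap
    (fun x => x ⟨n, Finset.mem_Iic.2 le_rfl⟩) (measurable_pi_apply _)

instance (M : Fin 2 → stdSimplex ℝ (Fin 2)) (n : ℕ) : IsMarkovKernel (stepKernel M n) :=
  ⟨fun x => by
    rw [stepKernel, Kernel.comap_apply]
    exact inferInstanceAs (IsProbabilityMeasure (vecMeasure _))⟩

/-- The law on `{0,1}^ℕ` of the Markov chain with initial probabilities `v` and transition
probabilities `M i j` from `i` to `j`. Time starts at `0`. -/
def chainLaw (v : stdSimplex ℝ (Fin 2)) (M : Fin 2 → stdSimplex ℝ (Fin 2)) :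
    Measure (ℕ → Fin 2) :=
  Kernel.trajMeasure (X := fun _ => Fin 2) (vecMeasure v) (stepKernel M)

/-- The initial probabilities `(1/(2-p), (1-p)/(2-p))`. -/
def initial (p : ℝ) (hp : p ∈ Set.Ioo (0 : ℝ) 1) : stdSimplex ℝ (Fin 2) :=
  ⟨![1 / (2 - p), (1 - p) / (2 - p)], by
    have h : 0 < 2 - p := by linarith [hp.2]
    have h' : 0 ≤ 1 - p := by linarith [hp.2]
    refine ⟨Fin.forall_fin_two.2 ⟨?_, ?_⟩, ?_⟩
    · simp only [Matrix.cons_val_zero]; positivity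
    · simp only [Matrix.cons_val_one]; exact div_nonneg h' h.le
    · simp only [Fin.sum_univ_two, Matrix.cons_val_zero, Matrix.cons_val_one]
      field_simp
      ring⟩

/-- The rows `(p, 1-p)` and `(1, 0)` of the transition matrix. -/
def transition (p : ℝ) (hp : p ∈ Set.Ioo (0 : ℝ) 1) : Fin 2 → stdSimplex ℝ (Fin 2) :=
  ![⟨![p, 1 - p], Fin.forall_fin_two.2 ⟨hp.1.le, by simpa using hp.2.le⟩, by simp⟩,
    ⟨![1, 0], Fin.forall_fin_two.2 ⟨by simp, by simp⟩, by simp⟩]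

/-- The law `ν_p` on `{0,1}^ℕ` of the Markov chain with transition matrix `(p, 1-p; 1, 0)` started
from `(1/(2-p), (1-p)/(2-p))`. -/
def nu (p : ℝ) (hp : p ∈ Set.Ioo (0 : ℝ) 1) : Measure (ℕ → Fin 2) :=
  chainLaw (initial p hp) (transition p hp)

/-- The number of ones among the first `n` entries of `s`. -/
def ones (s : ℕ → Fin 2) (n : ℕ) : ℕ := ∑ k ∈ Finset.range n, (s k : ℕ)

/-- The term of the series belonging to the `(i+1)`-st entry of `s`. The subtraction in the
exponent does not truncate, because `ones s n ≤ n`. -/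
def seriesTerm (β₀ β₁ : ℝ) (s : ℕ → Fin 2) (i : ℕ) : ℝ :=
  ((s i : ℕ) : ℝ) * β₁ ^ ones s (i + 1) * β₀ ^ (i + 1 - ones s (i + 1))

/-- The random series `S = ∑_{i ≥ 1} X_i β₁^{X̂_i} β₀^{i - X̂_i}` as a function of the path. -/
def series (β₀ β₁ : ℝ) (s : ℕ → Fin 2) : ℝ := ∑' i, seriesTerm β₀ β₁ s i

/-- The Markov geometric measure `μ_{β₀,β₁,p}`: the distribution of `S`. -/
def mu (β₀ β₁ p : ℝ) (hp : p ∈ Set.Ioo (0 : ℝ) 1) : Measure ℝ := (nu p hp).map (series β₀ β₁)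

/-- The Hausdorff dimension of a Borel probability measure on the line,
`inf {dim_H A | A Borel, μ(A) = 1}`. -/
def dimHMeasure (μ : Measure ℝ) : ENNReal :=
  sInf {d | ∃ A : Set ℝ, MeasurableSet A ∧ μ A = 1 ∧ dimH A = d}

/-! The next facts show that the series converges and that `mu` is a probability measure, so that
neither the infinite sum nor the image measure takes a default value. -/

instance (p : ℝ) (hp : p ∈ Set.Ioo (0 : ℝ) 1) : IsProbabilityMeasure (nu p hp) := by
  unfold nu chainLaw; infer_instance

theorem ones_le (s : ℕ → Fin 2) (n : ℕ) : ones s n ≤ n := by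
  calc ones s n ≤ ∑ _k ∈ Finset.range n, 1 :=
        Finset.sum_le_sum fun k _ => Nat.le_of_lt_succ (s k).isLt
    _ = n := by simp

theorem norm_term_le {β₀ β₁ : ℝ} (h₀ : β₀ ∈ Set.Ioo (0 : ℝ) 1) (h₁ : β₁ ∈ Set.Ioo (0 : ℝ) 1)
    (i : ℕ) (s : ℕ → Fin 2) : ‖seriesTerm β₀ β₁ s i‖ ≤ max β₀ β₁ ^ (i + 1) := by
  have hm : 0 ≤ max β₀ β₁ := h₀.1.le.trans (le_max_left _ _)
  have hs : ((s i : ℕ) : ℝ) ≤ 1 := by exact_mod_cast Nat.le_of_lt_succ (s i).isLt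
  have h0 := h₀.1.le
  have h1 := h₁.1.le
  rw [Real.norm_of_nonneg (by unfold seriesTerm; positivity), seriesTerm]
  calc _ ≤ 1 * max β₀ β₁ ^ ones s (i + 1) * max β₀ β₁ ^ (i + 1 - ones s (i + 1)) := by
        gcongr
        · exact le_max_right _ _
        · exact le_max_left _ _
    _ = _ := by rw [one_mul, ← pow_add, Nat.add_sub_cancel' (ones_le _ _)]

theorem summable_max {β₀ β₁ : ℝ} (h₀ : β₀ ∈ Set.Ioo (0 : ℝ) 1) (h₁ : β₁ ∈ Set.Ioo (0 : ℝ) 1) :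
    Summable fun i : ℕ => max β₀ β₁ ^ (i + 1) :=
  (summable_nat_add_iff 1).2 <|
    summable_geometric_of_lt_one (h₀.1.le.trans (le_max_left _ _)) (max_lt h₀.2 h₁.2)

theorem summable_term {β₀ β₁ : ℝ} (h₀ : β₀ ∈ Set.Ioo (0 : ℝ) 1) (h₁ : β₁ ∈ Set.Ioo (0 : ℝ) 1)
    (s : ℕ → Fin 2) : Summable (seriesTerm β₀ β₁ s) :=
  (summable_max h₀ h₁).of_norm_bounded fun i => norm_term_le h₀ h₁ i s

theorem measurable_series {β₀ β₁ : ℝ} (h₀ : β₀ ∈ Set.Ioo (0 : ℝ) 1)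
    (h₁ : β₁ ∈ Set.Ioo (0 : ℝ) 1) : Measurable (series β₀ β₁) := by
  have hones : ∀ n, Measurable fun s => ones s n := fun n =>
    Finset.measurable_fun_sum _ fun k _ =>
      (measurable_of_countable (fun a : Fin 2 => (a : ℕ))).comp (measurable_pi_apply k)
  refine measurable_of_tendsto_metrizable (f := fun n s => ∑ i ∈ Finset.range n, seriesTerm β₀ β₁ s i)
    (fun n => Finset.measurable_fun_sum _ fun i _ => ?_)
    (tendsto_pi_nhds.2 fun s => (summable_term h₀ h₁ s).hasSum.tendsto_sum_nat)
  refine (Measurable.mul ?_ ?_).mul ?_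
  · exact (measurable_of_countable (fun a : Fin 2 => ((a : ℕ) : ℝ))).comp (measurable_pi_apply i)
  · exact (measurable_of_countable (fun m : ℕ => β₁ ^ m)).comp (hones (i + 1))
  · exact (measurable_of_countable (fun m : ℕ => β₀ ^ (i + 1 - m))).comp (hones (i + 1))

theorem isProbabilityMeasure_mu {β₀ β₁ p : ℝ} (h₀ : β₀ ∈ Set.Ioo (0 : ℝ) 1)
    (h₁ : β₁ ∈ Set.Ioo (0 : ℝ) 1) (hp : p ∈ Set.Ioo (0 : ℝ) 1) :
    IsProbabilityMeasure (mu β₀ β₁ p hp) :=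
  Measure.isProbabilityMeasure_map (measurable_series h₀ h₁).aemeasurable

end

end MarkovGeometric

namespace MarkovGeometric

noncomputable section

open Filter

/-! Paths sharing their first `n` states have values of `series` within a constant times `scale`,
the product of the `n` contraction ratios (`dist_series_le`). The probability of the cylinder is, up
to bounded factors, `p` to the number of steps 0→0 times `1 - p` to the number of steps 0→1
(`log_cylProb`). Both are governed by the number of ones, whose frequency tends to `q =
(1-p)/(2-p)`. Hence log probability over log scale tends to the quotient `D` of the theorem, the
common factor `1/(2-p)` cancelling.

If `d > D`, then almost surely `scale ^ d ≤ cylProb` at all late times of the form `k ^ 2`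
(`ae_eventually_scale_rpow_le`). The balls of the words with this property satisfy `∑ diam ^ d ≤
(2C) ^ d`, because cylinder probabilities sum to one. So a set of full measure has dimension at most
`d` (`exists_measurableSet_dimH_le`). Letting `d` decrease to `D` bounds the dimension; some `d < 1`
gives singularity.

Such covers are needed only along a sequence of lengths. So convergence along the squares suffices,
and for this a second moment bound and Borel–Cantelli are enough. -/

/-! ### Self-similarity of the series -/

/-- The contraction ratio belonging to a state. -/
def ratio (β₀ β₁ : ℝ) (i : Fin 2) : ℝ := if i = 0 then β₀ else β₁

/-- The product of the contraction ratios of the first `n` states of a path. -/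
def scale (β₀ β₁ : ℝ) (s : ℕ → Fin 2) (n : ℕ) : ℝ := ∏ k ∈ Finset.range n, ratio β₀ β₁ (s k)

theorem ratio_pos {β₀ β₁ : ℝ} (h₀ : 0 < β₀) (h₁ : 0 < β₁) (i : Fin 2) : 0 < ratio β₀ β₁ i := by
  unfold ratio; split_ifs <;> assumption

theorem ratio_le_max (β₀ β₁ : ℝ) (i : Fin 2) : ratio β₀ β₁ i ≤ max β₀ β₁ := by
  unfold ratio; split_ifs
  exacts [le_max_left _ _, le_max_right _ _]

theorem scale_pos {β₀ β₁ : ℝ} (h₀ : 0 < β₀) (h₁ : 0 < β₁) (s : ℕ → Fin 2) (n : ℕ) :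
    0 < scale β₀ β₁ s n :=
  Finset.prod_pos fun _ _ => ratio_pos h₀ h₁ _

theorem scale_le_pow {β₀ β₁ : ℝ} (h₀ : 0 < β₀) (h₁ : 0 < β₁) (s : ℕ → Fin 2) (n : ℕ) :
    scale β₀ β₁ s n ≤ max β₀ β₁ ^ n := by
  calc scale β₀ β₁ s n ≤ ∏ _k ∈ Finset.range n, max β₀ β₁ :=
        Finset.prod_le_prod (fun _ _ => (ratio_pos h₀ h₁ _).le) fun _ _ => ratio_le_max _ _ _
    _ = max β₀ β₁ ^ n := by simp

theorem scale_congr (β₀ β₁ : ℝ) {s t : ℕ → Fin 2} {n : ℕ} (h : ∀ k < n, s k = t k) :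
    scale β₀ β₁ s n = scale β₀ β₁ t n :=
  Finset.prod_congr rfl fun k hk => by rw [h k (Finset.mem_range.1 hk)]

theorem ones_congr {s t : ℕ → Fin 2} {n : ℕ} (h : ∀ k < n, s k = t k) : ones s n = ones t n :=
  Finset.sum_congr rfl fun k hk => by rw [h k (Finset.mem_range.1 hk)]

theorem log_scale {β₀ β₁ : ℝ} (h₀ : 0 < β₀) (h₁ : 0 < β₁) (s : ℕ → Fin 2) (n : ℕ) :
    Real.log (scale β₀ β₁ s n) = ones s n * Real.log β₁ + (n - ones s n) * Real.log β₀ := by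
  have hlog : ∀ i : Fin 2, Real.log (ratio β₀ β₁ i) =
      ((i : ℕ) : ℝ) * Real.log β₁ + (1 - ((i : ℕ) : ℝ)) * Real.log β₀ := by
    rw [Fin.forall_fin_two]; simp [ratio]
  rw [scale, Real.log_prod fun k _ => (ratio_pos h₀ h₁ (s k)).ne']
  simp only [hlog, Finset.sum_add_distrib, ← Finset.sum_mul, ones, Nat.cast_sum,
    Finset.sum_sub_distrib, Finset.sum_const, Finset.card_range, nsmul_eq_mul, mul_one]

theorem ones_succ_eq_add_shift (s : ℕ → Fin 2) (n : ℕ) :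
    ones s (n + 1) = (s 0 : ℕ) + ones (fun k => s (k + 1)) n := by
  simp only [ones]
  rw [Finset.sum_range_succ', add_comm]

theorem seriesTerm_zero (β₀ β₁ : ℝ) (s : ℕ → Fin 2) :
    seriesTerm β₀ β₁ s 0 = ratio β₀ β₁ (s 0) * ((s 0 : ℕ) : ℝ) := by
  have : ∀ i : Fin 2, ((i : ℕ) : ℝ) * β₁ ^ (i : ℕ) * β₀ ^ (1 - (i : ℕ)) =
      ratio β₀ β₁ i * ((i : ℕ) : ℝ) := by
    rw [Fin.forall_fin_two]; simp [ratio]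
  simpa [seriesTerm, ones] using this (s 0)

theorem seriesTerm_succ (β₀ β₁ : ℝ) (s : ℕ → Fin 2) (i : ℕ) :
    seriesTerm β₀ β₁ s (i + 1) =
      ratio β₀ β₁ (s 0) * seriesTerm β₀ β₁ (fun k => s (k + 1)) i := by
  -- Keeps the subtraction in the exponent of `β₀` from truncating when the first state is 0.
  have hle := ones_le (fun k => s (k + 1)) (i + 1)
  simp only [seriesTerm, ones_succ_eq_add_shift s (i + 1)]
  generalize ones (fun k => s (k + 1)) (i + 1) = m at hle
  have : ∀ j : Fin 2, β₁ ^ ((j : ℕ) + m) * β₀ ^ (i + 1 + 1 - ((j : ℕ) + m)) =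
      ratio β₀ β₁ j * (β₁ ^ m * β₀ ^ (i + 1 - m)) := by
    rw [Fin.forall_fin_two]
    refine ⟨?_, ?_⟩
    · rw [show i + 1 + 1 - (((0 : Fin 2) : ℕ) + m) = (i + 1 - m) + 1 by simp; omega]
      simp [ratio]; ring
    · rw [show i + 1 + 1 - (((1 : Fin 2) : ℕ) + m) = i + 1 - m by simp; omega]
      simp [ratio]; ring
  rw [mul_assoc, this]; ring

theorem series_eq {β₀ β₁ : ℝ} (h₀ : β₀ ∈ Set.Ioo (0 : ℝ) 1) (h₁ : β₁ ∈ Set.Ioo (0 : ℝ) 1)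
    (s : ℕ → Fin 2) :
    series β₀ β₁ s =
      ratio β₀ β₁ (s 0) * (((s 0 : ℕ) : ℝ) + series β₀ β₁ fun k => s (k + 1)) := by
  rw [series, (summable_term h₀ h₁ s).tsum_eq_zero_add, seriesTerm_zero]
  simp only [seriesTerm_succ, tsum_mul_left]
  rw [series, mul_add]

theorem series_nonneg {β₀ β₁ : ℝ} (h₀ : 0 < β₀) (h₁ : 0 < β₁) (s : ℕ → Fin 2) :
    0 ≤ series β₀ β₁ s :=
  tsum_nonneg fun i => by unfold seriesTerm; positivity

theorem series_le {β₀ β₁ : ℝ} (h₀ : β₀ ∈ Set.Ioo (0 : ℝ) 1) (h₁ : β₁ ∈ Set.Ioo (0 : ℝ) 1)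
    (s : ℕ → Fin 2) : series β₀ β₁ s ≤ ∑' i : ℕ, max β₀ β₁ ^ (i + 1) :=
  (summable_term h₀ h₁ s).tsum_le_tsum
    (fun i => (Real.le_norm_self _).trans (norm_term_le h₀ h₁ i s)) (summable_max h₀ h₁)

/-- By `series_eq`, both values are images of tail values under the same `n` affine contractions,
and all tails lie in an interval of length the constant on the right. -/
theorem dist_series_le {β₀ β₁ : ℝ} (h₀ : β₀ ∈ Set.Ioo (0 : ℝ) 1) (h₁ : β₁ ∈ Set.Ioo (0 : ℝ) 1)
    {n : ℕ} {s t : ℕ → Fin 2} (h : ∀ k < n, s k = t k) :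
    dist (series β₀ β₁ s) (series β₀ β₁ t) ≤
      (∑' i : ℕ, max β₀ β₁ ^ (i + 1)) * scale β₀ β₁ s n := by
  induction n generalizing s t with
  | zero =>
    have h1 := series_le h₀ h₁ s
    have h2 := series_le h₀ h₁ t
    have h3 := series_nonneg h₀.1 h₁.1 s
    have h4 := series_nonneg h₀.1 h₁.1 t
    rw [Real.dist_eq, abs_le]
    simp only [scale, Finset.range_zero, Finset.prod_empty, mul_one]
    constructor <;> linarith
  | succ n ih =>
    have hr := ratio_pos h₀.1 h₁.1 (s 0)
    have key := ih (s := fun k => s (k + 1)) (t := fun k => t (k + 1))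
      fun k hk => h (k + 1) (by omega)
    rw [series_eq h₀ h₁ s, series_eq h₀ h₁ t, ← h 0 (by omega), Real.dist_eq, ← mul_sub,
      add_sub_add_left_eq_sub, abs_mul, abs_of_pos hr, ← Real.dist_eq]
    rw [show scale β₀ β₁ s (n + 1) = scale β₀ β₁ (fun k => s (k + 1)) n * ratio β₀ β₁ (s 0) from
      Finset.prod_range_succ' _ _]
    calc _ ≤ ratio β₀ β₁ (s 0) * _ := mul_le_mul_of_nonneg_left key hr.le
      _ = _ := by ring

/-! ### Finite words, the Markov property and cylinder probabilities -/

/-- The path that continues a finite word by zeros. -/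
def extend {n : ℕ} (w : Π _ : Finset.Iic n, Fin 2) : ℕ → Fin 2 :=
  fun k => if h : k ≤ n then w ⟨k, Finset.mem_Iic.2 h⟩ else 0

theorem extend_frestrictLe {n k : ℕ} (s : ℕ → Fin 2) (hk : k ≤ n) :
    extend (Preorder.frestrictLe (π := fun _ => Fin 2) n s) k = s k := by
  simp [extend, hk]

instance (v : stdSimplex ℝ (Fin 2)) (M : Fin 2 → stdSimplex ℝ (Fin 2)) :
    IsProbabilityMeasure (chainLaw v M) := by
  unfold chainLaw; infer_instance

/-- The initial word `s 0, …, s n` of a path. -/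
abbrev prefixWord (n : ℕ) (s : ℕ → Fin 2) : Π _ : Finset.Iic n, Fin 2 :=
  Preorder.frestrictLe (π := fun _ => Fin 2) n s

theorem measurable_prefixWord (n : ℕ) : Measurable (prefixWord n) :=
  Preorder.measurable_frestrictLe n

theorem integral_vecMeasure (v : stdSimplex ℝ (Fin 2)) (g : Fin 2 → ℝ) :
    ∫ j, g j ∂vecMeasure v = ∑ j, v.1 j * g j := by
  have hf : ∀ i, IsFiniteMeasure (ENNReal.ofReal (v.1 i) • Measure.dirac i) := fun i =>
    Measure.smul_finite _ ENNReal.ofReal_ne_top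
  rw [vecMeasure, integral_finsetSum_measure fun i _ => Integrable.of_finite]
  refine Finset.sum_congr rfl fun i _ => ?_
  rw [integral_smul_measure, integral_dirac, ENNReal.toReal_ofReal (v.2.1 i), smul_eq_mul]

/-- The Markov property. -/
theorem integral_prefixWord_succ (v : stdSimplex ℝ (Fin 2)) (M : Fin 2 → stdSimplex ℝ (Fin 2))
    (n : ℕ) (g : (Π _ : Finset.Iic n, Fin 2) × Fin 2 → ℝ) :
    ∫ s, g (prefixWord n s, s (n + 1)) ∂chainLaw v M =
      ∫ s, ∑ j, (M (s n)).1 j * g (prefixWord n s, j) ∂chainLaw v M := by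
  have hmeas : Measurable fun s : ℕ → Fin 2 => (prefixWord n s, s (n + 1)) :=
    (measurable_prefixWord n).prodMk (measurable_pi_apply _)
  have hcomp := Kernel.map_frestrictLe_trajMeasure_compProd_eq_map_trajMeasure
    (X := fun _ => Fin 2) (μ₀ := vecMeasure v) (κ := stepKernel M) (a := n)
  change (chainLaw v M).map (prefixWord n) ⊗ₘ stepKernel M n =
    (chainLaw v M).map (fun s => (prefixWord n s, s (n + 1))) at hcomp
  have : IsProbabilityMeasure ((chainLaw v M).map (prefixWord n)) :=
    Measure.isProbabilityMeasure_map (measurable_prefixWord n).aemeasurable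
  rw [← integral_map (f := g) hmeas.aemeasurable
    (measurable_of_countable g).aestronglyMeasurable, ← hcomp,
    Measure.integral_compProd Integrable.of_finite,
    integral_map (measurable_prefixWord n).aemeasurable
      (measurable_of_countable _).aestronglyMeasurable]
  refine integral_congr_ae (.of_forall fun s => ?_)
  change ∫ j, g (prefixWord n s, j) ∂vecMeasure (M (s n)) = _
  rw [integral_vecMeasure]

/-- The probability under `ν` of the cylinder of paths that start with the word `w`. -/
def cylProb (ν : Measure (ℕ → Fin 2)) (n : ℕ) (w : Π _ : Finset.Iic n, Fin 2) : ℝ :=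
  (ν.map (prefixWord n)).real {w}

theorem cylProb_nonneg (ν : Measure (ℕ → Fin 2)) (n : ℕ) (w : Π _ : Finset.Iic n, Fin 2) :
    0 ≤ cylProb ν n w :=
  measureReal_nonneg

theorem sum_cylProb (ν : Measure (ℕ → Fin 2)) [IsProbabilityMeasure ν] (n : ℕ) :
    ∑ w, cylProb ν n w = 1 := by
  have : IsProbabilityMeasure (ν.map (prefixWord n)) :=
    Measure.isProbabilityMeasure_map (measurable_prefixWord n).aemeasurable
  simp [cylProb]

/-- Only finitely many words of each length exist, so the null ones can be discarded together. This
removes paths with two adjacent ones and makes logarithms meaningful. -/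
theorem ae_cylProb_pos (ν : Measure (ℕ → Fin 2)) [IsProbabilityMeasure ν] :
    ∀ᵐ s ∂ν, ∀ n, 0 < cylProb ν n (prefixWord n s) := by
  refine ae_all_iff.2 fun n => ?_
  have : IsProbabilityMeasure (ν.map (prefixWord n)) :=
    Measure.isProbabilityMeasure_map (measurable_prefixWord n).aemeasurable
  refine ae_of_ae_map (p := fun w => 0 < cylProb ν n w) (measurable_prefixWord n).aemeasurable ?_
  rw [ae_iff_of_countable]
  intro w hw
  exact ENNReal.toReal_pos hw (measure_ne_top _ _)

theorem cylProb_eq_integral (ν : Measure (ℕ → Fin 2)) (n : ℕ) (w : Π _ : Finset.Iic n, Fin 2) :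
    cylProb ν n w = ∫ s, (if prefixWord n s = w then 1 else 0) ∂ν := by
  rw [cylProb, ← integral_indicator_one (measurableSet_singleton w),
    integral_map (measurable_prefixWord n).aemeasurable
      (measurable_of_countable _).aestronglyMeasurable]
  simp [Set.indicator_apply]

theorem prefixWord_succ_eq_iff {n : ℕ} {s t : ℕ → Fin 2} :
    prefixWord (n + 1) t = prefixWord (n + 1) s ↔
      prefixWord n t = prefixWord n s ∧ t (n + 1) = s (n + 1) := by
  have (m : ℕ) : prefixWord m t = prefixWord m s ↔ ∀ k ≤ m, t k = s k :=
    ⟨fun h k hk => congrFun h ⟨k, Finset.mem_Iic.2 hk⟩,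
      fun h => funext fun k => h k (Finset.mem_Iic.1 k.2)⟩
  rw [this, this]
  refine ⟨fun h => ⟨fun k hk => h k (by omega), h _ le_rfl⟩, fun h k hk => ?_⟩
  rcases Nat.le_succ_iff.1 hk with hk | rfl
  exacts [h.1 k hk, h.2]

theorem cylProb_succ (v : stdSimplex ℝ (Fin 2)) (M : Fin 2 → stdSimplex ℝ (Fin 2)) (n : ℕ)
    (s : ℕ → Fin 2) :
    cylProb (chainLaw v M) (n + 1) (prefixWord (n + 1) s) =
      (M (s n)).1 (s (n + 1)) * cylProb (chainLaw v M) n (prefixWord n s) := by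
  rw [cylProb_eq_integral, cylProb_eq_integral, ← integral_const_mul]
  simp only [prefixWord_succ_eq_iff]
  refine (integral_prefixWord_succ v M n
    (fun x => if x.1 = prefixWord n s ∧ x.2 = s (n + 1) then 1 else 0)).trans ?_
  refine integral_congr_ae (.of_forall fun t => ?_)
  by_cases h : prefixWord n t = prefixWord n s
  · have hn : t n = s n := congrFun h ⟨n, Finset.mem_Iic.2 le_rfl⟩
    simp [h, hn]
  · simp [h]

/-- On paths all of whose initial words have positive probability, this probability is explicit
up to the weight of the initial state. -/
theorem log_cylProb {p : ℝ} (hp : p ∈ Set.Ioo (0 : ℝ) 1) (v : stdSimplex ℝ (Fin 2))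
    {s : ℕ → Fin 2}
    (hs : ∀ n, 0 < cylProb (chainLaw v (transition p hp)) n (prefixWord n s)) (n : ℕ) :
    Real.log (cylProb (chainLaw v (transition p hp)) n (prefixWord n s)) =
      Real.log (cylProb (chainLaw v (transition p hp)) 0 (prefixWord 0 s)) +
        (n - 2 * ones s (n + 1) + ((s 0 : ℕ) : ℝ) + ((s n : ℕ) : ℝ)) * Real.log p +
        (ones s (n + 1) - ((s 0 : ℕ) : ℝ)) * Real.log (1 - p) := by
  -- Among the `n` steps, each one except an initial one is entered by 0→1, and each one except a
  -- final one is left by 1→0; the remaining steps are 0→0.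
  induction n with
  | zero => simp [ones]; ring_nf; simp
  | succ n ih =>
    have hpos := hs (n + 1)
    rw [cylProb_succ] at hpos ⊢
    have hM : (transition p hp (s n)).1 (s (n + 1)) ≠ 0 := by
      intro h0; simp [h0] at hpos
    rw [Real.log_mul hM (hs n).ne', ih,
      show ones s (n + 1 + 1) = ones s (n + 1) + (s (n + 1) : ℕ) from Finset.sum_range_succ _ _]
    generalize s (n + 1) = j at hM ⊢
    generalize s n = i at hM ⊢
    fin_cases i <;> fin_cases j <;> simp [transition] at hM ⊢ <;> try left
    all_goals ring

/-! ### Law of large numbers for the number of ones -/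

/-- The stationary probability of the state `1`. -/
def freq (p : ℝ) : ℝ := (1 - p) / (2 - p)

theorem freq_mul {p : ℝ} (hp : p ∈ Set.Ioo (0 : ℝ) 1) : freq p * (2 - p) = 1 - p :=
  div_mul_cancel₀ _ (by linarith [hp.2])

theorem freq_nonneg {p : ℝ} (hp : p ∈ Set.Ioo (0 : ℝ) 1) : 0 ≤ freq p :=
  div_nonneg (by linarith [hp.2]) (by linarith [hp.2])

theorem two_mul_freq_le {p : ℝ} (hp : p ∈ Set.Ioo (0 : ℝ) 1) : 2 * freq p ≤ 1 := by
  by_contra! hc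
  nlinarith [hp.1, hp.2, freq_mul hp]

/-- The number of ones among the first `n + 1` states, centred and corrected by a function of the
last state so that it becomes a martingale. -/
def centredOnes (p : ℝ) (s : ℕ → Fin 2) (n : ℕ) : ℝ :=
  ones s (n + 1) - (n + 1) * freq p - freq p * ((s n : ℕ) : ℝ)

/-- From state 1 the increment of `centredOnes` vanishes. From state 0 it is `-q` or `1 - 2q`, with
mean zero (`hdrift`) and variance at most one (`hvar`), so the cross term with `z` disappears. -/
theorem sum_transition_mul_sq_le {p : ℝ} (hp : p ∈ Set.Ioo (0 : ℝ) 1) (n : ℕ) (s : ℕ → Fin 2) :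
    ∑ j, (transition p hp (s n)).1 j *
      ((ones s (n + 1) : ℝ) + ((j : ℕ) : ℝ) - (n + 1 + 1) * freq p - freq p * ((j : ℕ) : ℝ)) ^ 2 ≤
      centredOnes p s n ^ 2 + 1 := by
  have hq := freq_mul hp
  have hq0 := freq_nonneg hp
  have hq1 := two_mul_freq_le hp
  obtain ⟨z, hz⟩ : ∃ z, z = centredOnes p s n := ⟨_, rfl⟩
  have ho : (ones s (n + 1) : ℝ) = z + (n + 1) * freq p + freq p * ((s n : ℕ) : ℝ) := by
    rw [hz, centredOnes]; ring
  rw [ho, ← hz]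
  clear ho hz
  generalize freq p = q at *
  have hdrift : -(p * q) + (1 - p) * (1 - 2 * q) = 0 := by linarith
  have hvar : p * q ^ 2 + (1 - p) * (1 - 2 * q) ^ 2 ≤ 1 := by
    have h1 : p * q ^ 2 ≤ p * 1 :=
      mul_le_mul_of_nonneg_left (pow_le_one₀ hq0 (by linarith)) hp.1.le
    have h2 : (1 - p) * (1 - 2 * q) ^ 2 ≤ (1 - p) * 1 :=
      mul_le_mul_of_nonneg_left (pow_le_one₀ (by linarith) (by linarith)) (by linarith [hp.2])
    linarith
  have hrows : ∀ i : Fin 2, ∑ j, (transition p hp i).1 j *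
      (z + (n + 1) * q + q * ((i : ℕ) : ℝ) + ((j : ℕ) : ℝ) - (n + 1 + 1) * q -
        q * ((j : ℕ) : ℝ)) ^ 2 ≤ z ^ 2 + 1 := by
    rw [Fin.forall_fin_two]
    constructor <;> simp [transition, Fin.sum_univ_two]
    · linear_combination (2 * z) * hdrift + hvar
    · linear_combination (zero_le_one (α := ℝ))
  exact hrows (s n)

/-- The function factors through a finite space, where everything is integrable. -/
theorem integrable_of_forall_eq_prefixWord {ν : Measure (ℕ → Fin 2)} [IsFiniteMeasure ν] {n : ℕ}
    {f : (ℕ → Fin 2) → ℝ} (g : (Π _ : Finset.Iic n, Fin 2) → ℝ)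
    (h : ∀ s, f s = g (prefixWord n s)) : Integrable f ν := by
  have : IsFiniteMeasure (ν.map (prefixWord n)) := Measure.isFiniteMeasure_map ν _
  rw [funext h]
  exact Integrable.comp_measurable (f := prefixWord n) (Integrable.of_finite)
    (measurable_prefixWord n)

theorem ones_extend_prefixWord (n : ℕ) (s : ℕ → Fin 2) :
    ones (extend (prefixWord n s)) (n + 1) = ones s (n + 1) :=
  ones_congr fun _ hk => extend_frestrictLe s (Nat.le_of_lt_succ hk)

theorem extend_prefixWord_self (n : ℕ) (s : ℕ → Fin 2) : extend (prefixWord n s) n = s n :=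
  extend_frestrictLe s le_rfl

theorem centredOnes_extend_prefixWord (p : ℝ) (n : ℕ) (s : ℕ → Fin 2) :
    centredOnes p (extend (prefixWord n s)) n = centredOnes p s n := by
  rw [centredOnes, ones_extend_prefixWord, extend_prefixWord_self, centredOnes]

theorem integrable_centredOnes_sq (ν : Measure (ℕ → Fin 2)) [IsFiniteMeasure ν] (p : ℝ) (n : ℕ) :
    Integrable (fun s => centredOnes p s n ^ 2) ν :=
  integrable_of_forall_eq_prefixWord (fun w => centredOnes p (extend w) n ^ 2)
    fun s => by rw [centredOnes_extend_prefixWord]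

theorem integral_centredOnes_sq_succ_le {p : ℝ} (hp : p ∈ Set.Ioo (0 : ℝ) 1)
    (v : stdSimplex ℝ (Fin 2)) (n : ℕ) :
    ∫ s, centredOnes p s (n + 1) ^ 2 ∂chainLaw v (transition p hp) ≤
      ∫ s, centredOnes p s n ^ 2 ∂chainLaw v (transition p hp) + 1 := by
  let F : ℕ → Fin 2 → ℝ := fun m j =>
    ((m : ℝ) + ((j : ℕ) : ℝ) - (n + 1 + 1) * freq p - freq p * ((j : ℕ) : ℝ)) ^ 2
  let G : (ℕ → Fin 2) → ℝ := fun s => ∑ j, (transition p hp (s n)).1 j * F (ones s (n + 1)) j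
  have hstep : ∫ s, centredOnes p s (n + 1) ^ 2 ∂chainLaw v (transition p hp) =
      ∫ s, G s ∂chainLaw v (transition p hp) := by
    have step := integral_prefixWord_succ v (transition p hp) n fun x =>
      F (ones (extend x.1) (n + 1)) x.2
    simp only [ones_extend_prefixWord] at step
    refine (integral_congr_ae (.of_forall fun s => ?_)).trans step
    simp only [centredOnes, F,
      show ones s (n + 1 + 1) = ones s (n + 1) + (s (n + 1) : ℕ) from Finset.sum_range_succ _ _]
    push_cast; rfl
  have hG : Integrable G (chainLaw v (transition p hp)) :=
    integrable_of_forall_eq_prefixWord (n := n) (fun w => G (extend w)) fun s => by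
      simp only [G, ones_extend_prefixWord, extend_prefixWord_self]
  have hZ := integrable_centredOnes_sq (chainLaw v (transition p hp)) p n
  rw [hstep]
  refine (integral_mono hG (hZ.add (integrable_const 1))
    (sum_transition_mul_sq_le hp n)).trans_eq ?_
  rw [integral_add' hZ (integrable_const 1)]
  simp

theorem integral_centredOnes_sq_le {p : ℝ} (hp : p ∈ Set.Ioo (0 : ℝ) 1)
    (v : stdSimplex ℝ (Fin 2)) (n : ℕ) :
    ∫ s, centredOnes p s n ^ 2 ∂chainLaw v (transition p hp) ≤ n + 1 := by
  induction n with
  | zero =>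
    have hq0 := freq_nonneg hp
    have hq1 := two_mul_freq_le hp
    have hbound : ∀ s : ℕ → Fin 2, ‖centredOnes p s 0 ^ 2‖ ≤ 1 := by
      intro s
      rw [Real.norm_of_nonneg (sq_nonneg _)]
      have : ∀ i : Fin 2, (((i : ℕ) : ℝ) - freq p - freq p * ((i : ℕ) : ℝ)) ^ 2 ≤ 1 := by
        rw [Fin.forall_fin_two]
        constructor <;> simp <;> rw [abs_le] <;> constructor <;> linarith
      simpa [centredOnes, ones] using this (s 0)
    refine (Real.le_norm_self _).trans ((norm_integral_le_of_norm_le_const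
      (.of_forall hbound)).trans ?_)
    simp
  | succ n ih =>
    push_cast
    linarith [integral_centredOnes_sq_succ_le hp v n]

theorem measure_le_abs_centredOnes {p : ℝ} (hp : p ∈ Set.Ioo (0 : ℝ) 1)
    (v : stdSimplex ℝ (Fin 2)) {ε : ℝ} (hε : 0 < ε) (n : ℕ) :
    chainLaw v (transition p hp) {s | ε * (n + 1) ≤ |centredOnes p s n|} ≤
      ENNReal.ofReal (ε⁻¹ ^ 2 * (1 / (n + 1))) := by
  set ν := chainLaw v (transition p hp)
  have hset : {s | ε * (n + 1) ≤ |centredOnes p s n|} =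
      {s | (ε * (n + 1)) ^ 2 ≤ centredOnes p s n ^ 2} := by
    ext s
    rw [Set.mem_ofPred, Set.mem_ofPred, ← sq_abs (centredOnes p s n),
      pow_le_pow_iff_left₀ (by positivity) (abs_nonneg _) two_ne_zero]
  have hint := integrable_centredOnes_sq ν p n
  have hmarkov := mul_meas_ge_le_integral_of_nonneg (μ := ν)
    (.of_forall fun s => sq_nonneg (centredOnes p s n)) hint ((ε * (n + 1)) ^ 2)
  rw [← hset] at hmarkov
  rw [← ofReal_measureReal]
  refine ENNReal.ofReal_le_ofReal ?_
  have hn : (0 : ℝ) < n + 1 := by positivity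
  have h4 := hmarkov.trans (integral_centredOnes_sq_le hp v n)
  rw [show ε⁻¹ ^ 2 * (1 / ((n : ℝ) + 1)) = (n + 1) / (ε * (n + 1)) ^ 2 by field_simp,
    le_div_iff₀ (by positivity), mul_comm]
  exact h4

/-- Along the squares the frequency of ones converges almost surely. -/
theorem ae_eventually_abs_centredOnes_lt {p : ℝ} (hp : p ∈ Set.Ioo (0 : ℝ) 1)
    (v : stdSimplex ℝ (Fin 2)) {ε : ℝ} (hε : 0 < ε) :
    ∀ᵐ s ∂chainLaw v (transition p hp), ∀ᶠ k : ℕ in Filter.atTop,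
      |centredOnes p s (k ^ 2)| < ε * (((k ^ 2 : ℕ) : ℝ) + 1) := by
  have hsum : ∑' k : ℕ, chainLaw v (transition p hp)
      {s | ε * (((k ^ 2 : ℕ) : ℝ) + 1) ≤ |centredOnes p s (k ^ 2)|} ≠ ⊤ := by
    -- The Chebyshev bound is of order `1/n`, which is summable along squares but not over all `n`.
    have hs : Summable fun k : ℕ => ε⁻¹ ^ 2 * (1 / (((k ^ 2 : ℕ) : ℝ) + 1)) := by
      refine Summable.mul_left _ ?_
      refine Summable.of_norm_bounded_eventually_nat
        (Real.summable_one_div_nat_pow.2 one_lt_two) ?_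
      filter_upwards [Filter.eventually_gt_atTop 0] with k hk
      have : (0 : ℝ) < k := by exact_mod_cast hk
      rw [Real.norm_of_nonneg (by positivity)]
      push_cast
      gcongr
      linarith
    refine ne_top_of_le_ne_top hs.tsum_ofReal_ne_top
      (ENNReal.tsum_le_tsum fun k => measure_le_abs_centredOnes hp v hε (k ^ 2))
  filter_upwards [ae_eventually_notMem hsum] with s hs
  filter_upwards [hs] with k hk
  simpa using hk

/-! ### Cylinder probability against scale -/

theorem ae_eventually_scale_rpow_le {β₀ β₁ p d : ℝ} (h₀ : 0 < β₀) (h₁ : 0 < β₁)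
    (hp : p ∈ Set.Ioo (0 : ℝ) 1) (v : stdSimplex ℝ (Fin 2))
    (hd : d * (Real.log β₀ + (1 - p) * Real.log β₁) <
      p * Real.log p + (1 - p) * Real.log (1 - p)) :
    ∀ᵐ s ∂chainLaw v (transition p hp), ∀ᶠ k : ℕ in atTop,
      scale β₀ β₁ s (k ^ 2 + 1) ^ d ≤
        cylProb (chainLaw v (transition p hp)) (k ^ 2) (prefixWord (k ^ 2) s) := by
  have ha : Real.log p < 0 := Real.log_neg hp.1 hp.2
  have hb : Real.log (1 - p) < 0 := Real.log_neg (by linarith [hp.2]) (by linarith [hp.1])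
  have hq := freq_mul hp
  have hq0 := freq_nonneg hp
  have hq1 := two_mul_freq_le hp
  -- `κ` is the limiting rate per step of log probability minus `d` times log scale; times `2 - p`
  -- it is the gap in `hd`.
  obtain ⟨κ, hκ⟩ : ∃ κ, κ = (1 - 2 * freq p) * Real.log p + freq p * Real.log (1 - p) -
      d * (freq p * Real.log β₁ + (1 - freq p) * Real.log β₀) := ⟨_, rfl⟩
  have hκ0 : 0 < κ := by
    have : κ * (2 - p) = p * Real.log p + (1 - p) * Real.log (1 - p) -
        d * (Real.log β₀ + (1 - p) * Real.log β₁) := by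
      rw [hκ]
      linear_combination (-2 * Real.log p + Real.log (1 - p) - d * Real.log β₁ +
        d * Real.log β₀) * hq
    exact pos_of_mul_pos_left (by rw [this]; linarith) (by linarith [hp.2] : 0 ≤ 2 - p)
  -- `R` is the price of one unit of deviation in the number of ones. With the tolerance `κ / (2 *
  -- (R + 1))` deviations use at most half of the rate; the other half absorbs the constants in
  -- `hlarge`.
  obtain ⟨R, hR⟩ : ∃ R, R = |Real.log (1 - p) - 2 * Real.log p -
      d * (Real.log β₁ - Real.log β₀)| := ⟨_, rfl⟩
  have hR0 : 0 ≤ R := hR ▸ abs_nonneg _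
  have hε : 0 < κ / (2 * (R + 1)) := by positivity
  filter_upwards [ae_cylProb_pos (chainLaw v (transition p hp)),
    ae_eventually_abs_centredOnes_lt hp v hε] with s hs hZ
  have hlarge : ∀ᶠ k : ℕ in atTop,
      R - Real.log (cylProb (chainLaw v (transition p hp)) 0 (prefixWord 0 s)) - Real.log p ≤
        (((k ^ 2 : ℕ) : ℝ) + 1) * (κ / 2) :=
    ((tendsto_atTop_add_const_right _ _ (tendsto_natCast_atTop_atTop.comp
      (tendsto_pow_atTop two_ne_zero))).atTop_mul_const (half_pos hκ0)).eventually_ge_atTop _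
  filter_upwards [hZ, hlarge] with k hk hlk
  rw [← Real.log_le_log_iff (Real.rpow_pos_of_pos (scale_pos h₀ h₁ _ _) _) (hs _),
    Real.log_rpow (scale_pos h₀ h₁ _ _), log_scale h₀ h₁, log_cylProb hp v hs]
  generalize k ^ 2 = n at hk hlk ⊢
  generalize Real.log (cylProb (chainLaw v (transition p hp)) 0 (prefixWord 0 s)) = L at hlk ⊢
  obtain ⟨δ, hδ⟩ : ∃ δ : ℝ, δ = ones s (n + 1) - (n + 1) * freq p := ⟨_, rfl⟩
  have hx : ∀ i : Fin 2, (0 : ℝ) ≤ ((i : ℕ) : ℝ) ∧ ((i : ℕ) : ℝ) ≤ 1 := fun i =>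
    ⟨Nat.cast_nonneg _, by exact_mod_cast Nat.le_of_lt_succ i.isLt⟩
  obtain ⟨hx0, hx0'⟩ := hx (s 0)
  obtain ⟨hxn, hxn'⟩ := hx (s n)
  rw [centredOnes, ← hδ] at hk
  have ho : (ones s (n + 1) : ℝ) = δ + (n + 1) * freq p := by rw [hδ]; ring
  rw [ho]
  generalize ((s 0 : ℕ) : ℝ) = x at *
  generalize ((s n : ℕ) : ℝ) = y at *
  have hδ' : |δ| ≤ κ / (2 * (R + 1)) * (n + 1) + 1 := by
    have h1 : |δ| ≤ |δ - freq p * y| + |freq p * y| := by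
      simpa using abs_add_le (δ - freq p * y) (freq p * y)
    have h2 : |freq p * y| ≤ 1 := by
      rw [abs_of_nonneg (by positivity)]
      exact mul_le_one₀ (by linarith) hxn hxn'
    linarith
  have hδR : |δ| * R ≤ (n + 1) * (κ / 2) + R := by
    have h1 : κ / (2 * (R + 1)) * R ≤ κ / 2 := by
      rw [div_mul_eq_mul_div, div_le_div_iff₀ (by positivity) two_pos]
      nlinarith
    have h2 := mul_le_mul_of_nonneg_right hδ' hR0
    have h3 := mul_le_mul_of_nonneg_left h1 (by positivity : (0 : ℝ) ≤ n + 1)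
    linarith
  have hcross : -(|δ| * R) ≤ δ * (Real.log (1 - p) - 2 * Real.log p -
      d * (Real.log β₁ - Real.log β₀)) := by
    rw [hR, ← abs_mul]; exact neg_abs_le _
  -- The `-1` arises because `n + 1` states have only `n` transitions.
  have hxa : Real.log p ≤ (-1 + x + y) * Real.log p := by nlinarith
  have hxb : 0 ≤ -(x * Real.log (1 - p)) := by nlinarith
  push_cast
  linear_combination hlk + hδR + hcross + hxa + hxb + (n + 1 : ℝ) * hκ

/-! ### Coverings and Hausdorff dimension -/

/-- The union of the balls that are the images of the cylinders of length `n + 1` whose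
probability is at least the `d`-th power of their scale. -/
def ballCover (β₀ β₁ d : ℝ) (ν : Measure (ℕ → Fin 2)) (n : ℕ) : Set ℝ :=
  ⋃ w : Π _ : Finset.Iic n, Fin 2, ⋃ _ : scale β₀ β₁ (extend w) (n + 1) ^ d ≤ cylProb ν n w,
    Metric.closedBall (series β₀ β₁ (extend w))
      ((∑' i : ℕ, max β₀ β₁ ^ (i + 1)) * scale β₀ β₁ (extend w) (n + 1))

theorem measurableSet_ballCover (β₀ β₁ d : ℝ) (ν : Measure (ℕ → Fin 2)) (n : ℕ) :
    MeasurableSet (ballCover β₀ β₁ d ν n) :=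
  .iUnion fun _ => .iUnion fun _ => measurableSet_closedBall

theorem series_mem_ballCover {β₀ β₁ d : ℝ} (h₀ : β₀ ∈ Set.Ioo (0 : ℝ) 1)
    (h₁ : β₁ ∈ Set.Ioo (0 : ℝ) 1) {ν : Measure (ℕ → Fin 2)} {n : ℕ} {s : ℕ → Fin 2}
    (hs : scale β₀ β₁ s (n + 1) ^ d ≤ cylProb ν n (prefixWord n s)) :
    series β₀ β₁ s ∈ ballCover β₀ β₁ d ν n := by
  have hext : ∀ k < n + 1, s k = extend (prefixWord n s) k := fun k hk =>
    (extend_frestrictLe s (Nat.le_of_lt_succ hk)).symm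
  refine Set.mem_iUnion₂.2 ⟨prefixWord n s, ?_, ?_⟩
  · rwa [← scale_congr β₀ β₁ hext]
  · rw [Metric.mem_closedBall, ← scale_congr β₀ β₁ hext]
    exact dist_series_le h₀ h₁ hext

/-- Every stage from `K` on covers the intersection by sets whose `d`-th powers of diameters sum to
at most `(2C) ^ d`, with diameters tending to zero uniformly. So its `d`-dimensional Hausdorff
measure is finite. -/
theorem dimH_iInter_ballCover_le {β₀ β₁ d : ℝ} (h₀ : β₀ ∈ Set.Ioo (0 : ℝ) 1)
    (h₁ : β₁ ∈ Set.Ioo (0 : ℝ) 1) (hd : 0 < d) (ν : Measure (ℕ → Fin 2)) [IsProbabilityMeasure ν]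
    {u : ℕ → ℕ} (hu : Tendsto u atTop atTop) (K : ℕ) :
    dimH (⋂ k ≥ K, ballCover β₀ β₁ d ν (u k)) ≤ ENNReal.ofReal d := by
  set C : ℝ := ∑' i : ℕ, max β₀ β₁ ^ (i + 1)
  have hmax0 : 0 ≤ max β₀ β₁ := h₀.1.le.trans (le_max_left _ _)
  have hC : 0 ≤ C := tsum_nonneg fun i => pow_nonneg hmax0 _
  let t : ∀ k : ℕ, (Π _ : Finset.Iic (u k), Fin 2) → Set ℝ := fun k w =>
    ⋃ _ : scale β₀ β₁ (extend w) (u k + 1) ^ d ≤ cylProb ν (u k) w,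
      Metric.closedBall (series β₀ β₁ (extend w)) (C * scale β₀ β₁ (extend w) (u k + 1))
  have hdiam : ∀ k w, Metric.ediam (t k w) ≤
      ENNReal.ofReal (2 * (C * scale β₀ β₁ (extend w) (u k + 1))) := by
    intro k w
    refine (Metric.ediam_mono (Set.iUnion_subset fun _ => subset_rfl)).trans ?_
    rw [Real.closedBall_eq_Icc, Real.ediam_Icc]
    exact ENNReal.ofReal_le_ofReal (by linarith)
  have hdiam_rpow : ∀ k w, Metric.ediam (t k w) ^ d ≤
      ENNReal.ofReal ((2 * C) ^ d) * ENNReal.ofReal (cylProb ν (u k) w) := by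
    intro k w
    by_cases hw : scale β₀ β₁ (extend w) (u k + 1) ^ d ≤ cylProb ν (u k) w
    · have hpos := (scale_pos h₀.1 h₁.1 (extend w) (u k + 1)).le
      refine (ENNReal.rpow_le_rpow (hdiam k w) hd.le).trans ?_
      rw [ENNReal.ofReal_rpow_of_nonneg (by positivity) hd.le, ← mul_assoc,
        Real.mul_rpow (by positivity) hpos, ENNReal.ofReal_mul (by positivity)]
      gcongr
    -- A rejected word contributes the empty set, and `0 ^ d = 0` since `d > 0`.
    · simp [t, hw, hd]
  have hlim : Tendsto (fun k : ℕ => ENNReal.ofReal (2 * (C * max β₀ β₁ ^ (u k + 1)))) atTop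
      (nhds 0) := by
    have h1 : Tendsto (fun k : ℕ => u k + 1) atTop atTop :=
      (tendsto_add_atTop_nat 1).comp hu
    have h2 := (((tendsto_pow_atTop_nhds_zero_of_lt_one hmax0
      (max_lt h₀.2 h₁.2)).comp h1).const_mul C).const_mul 2
    simpa using ENNReal.tendsto_ofReal h2
  have hH := Measure.hausdorffMeasure_le_liminf_sum d (⋂ k ≥ K, ballCover β₀ β₁ d ν (u k))
    (fun k : ℕ => ENNReal.ofReal (2 * (C * max β₀ β₁ ^ (u k + 1)))) hlim t
    (.of_forall fun k w => (hdiam k w).trans <| ENNReal.ofReal_le_ofReal <| by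
      gcongr; exact scale_le_pow h₀.1 h₁.1 _ _)
    (by filter_upwards [eventually_ge_atTop K] with k hk using Set.biInter_subset_of_mem hk)
  have hsum : ∀ k, ∑ w, Metric.ediam (t k w) ^ d ≤ ENNReal.ofReal ((2 * C) ^ d) := by
    intro k
    refine (Finset.sum_le_sum fun w _ => hdiam_rpow k w).trans_eq ?_
    rw [← Finset.mul_sum, ← ENNReal.ofReal_sum_of_nonneg fun w _ => cylProb_nonneg ν (u k) w,
      sum_cylProb, ENNReal.ofReal_one, mul_one]
  have hfin : μH[(d.toNNReal : ℝ)] (⋂ k ≥ K, ballCover β₀ β₁ d ν (u k)) ≠ ⊤ := by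
    rw [Real.coe_toNNReal d hd.le]
    refine ne_top_of_le_ne_top ENNReal.ofReal_ne_top
      (hH.trans ((liminf_le_liminf (.of_forall hsum)).trans_eq (liminf_const _)))
  exact dimH_le_of_hausdorffMeasure_ne_top hfin

theorem exists_measurableSet_dimH_le {β₀ β₁ p d : ℝ} (h₀ : β₀ ∈ Set.Ioo (0 : ℝ) 1)
    (h₁ : β₁ ∈ Set.Ioo (0 : ℝ) 1) (hp : p ∈ Set.Ioo (0 : ℝ) 1)
    (hd : (p * Real.log p + (1 - p) * Real.log (1 - p)) /
      (Real.log β₀ + (1 - p) * Real.log β₁) < d) :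
    ∃ A : Set ℝ, MeasurableSet A ∧ mu β₀ β₁ p hp A = 1 ∧ dimH A ≤ ENNReal.ofReal d := by
  have hnum : p * Real.log p + (1 - p) * Real.log (1 - p) < 0 := by
    have := Real.log_neg hp.1 hp.2
    have := Real.log_neg (sub_pos.2 hp.2) (by linarith [hp.1])
    nlinarith [hp.1, hp.2]
  have hden : Real.log β₀ + (1 - p) * Real.log β₁ < 0 := by
    have := Real.log_neg h₀.1 h₀.2
    have := Real.log_neg h₁.1 h₁.2
    nlinarith [hp.1, hp.2]
  have hd0 : 0 < d := (div_pos_of_neg_of_neg hnum hden).trans hd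
  have hmeas : MeasurableSet (⋃ K : ℕ, ⋂ k ≥ K, ballCover β₀ β₁ d (nu p hp) (k ^ 2)) :=
    .iUnion fun K => .iInter fun k => .iInter fun _ => measurableSet_ballCover _ _ _ _ _
  refine ⟨⋃ K : ℕ, ⋂ k ≥ K, ballCover β₀ β₁ d (nu p hp) (k ^ 2), hmeas, ?_, ?_⟩
  · rw [mu, Measure.map_apply (measurable_series h₀ h₁) hmeas,
      ← mem_ae_iff_prob_eq_one (measurable_series h₀ h₁ hmeas)]
    filter_upwards [ae_eventually_scale_rpow_le h₀.1 h₁.1 hp (initial p hp)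
      ((div_lt_iff_of_neg hden).1 hd)] with s hs
    obtain ⟨K, hK⟩ := eventually_atTop.1 hs
    exact Set.mem_iUnion.2 ⟨K, Set.mem_iInter₂.2 fun k hk =>
      series_mem_ballCover h₀ h₁ (hK k hk)⟩
  · rw [dimH_iUnion]
    exact iSup_le fun K => dimH_iInter_ballCover_le h₀ h₁ hd0 _
      (tendsto_pow_atTop two_ne_zero) K

end

end MarkovGeometric

theorem theorem3p1 (β₀ β₁ p : ℝ) (hβ₀ : β₀ ∈ Set.Ioo (0 : ℝ) 1) (hβ₁ : β₁ ∈ Set.Ioo (0 : ℝ) 1)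
    (hp : p ∈ Set.Ioo (0 : ℝ) 1)
    (h : β₀ * β₁ ^ (1 - p) < p ^ p * (1 - p) ^ (1 - p)) :
    Measure.MutuallySingular (MarkovGeometric.mu β₀ β₁ p hp) volume ∧
      MarkovGeometric.dimHMeasure (MarkovGeometric.mu β₀ β₁ p hp) ≤
        ENNReal.ofReal ((p * Real.log p + (1 - p) * Real.log (1 - p)) /
          (Real.log β₀ + (1 - p) * Real.log β₁)) := by
  have hp' : 0 < 1 - p := sub_pos.2 hp.2
  have hlog : Real.log β₀ + (1 - p) * Real.log β₁ <
      p * Real.log p + (1 - p) * Real.log (1 - p) := by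
    have hβ := Real.rpow_pos_of_pos hβ₁.1 (1 - p)
    have := Real.log_lt_log (mul_pos hβ₀.1 hβ) h
    rwa [Real.log_mul hβ₀.1.ne' hβ.ne', Real.log_rpow hβ₁.1,
      Real.log_mul (Real.rpow_pos_of_pos hp.1 _).ne' (Real.rpow_pos_of_pos hp' _).ne',
      Real.log_rpow hp.1, Real.log_rpow hp'] at this
  have hnum : p * Real.log p + (1 - p) * Real.log (1 - p) < 0 := by
    have := Real.log_neg hp.1 hp.2
    have := Real.log_neg hp' (by linarith [hp.1])
    nlinarith [hp.1, hp.2]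
  have hden := hlog.trans hnum
  have hlt : (p * Real.log p + (1 - p) * Real.log (1 - p)) /
      (Real.log β₀ + (1 - p) * Real.log β₁) < 1 := by
    rw [div_lt_iff_of_neg hden]; linarith
  have := MarkovGeometric.isProbabilityMeasure_mu hβ₀ hβ₁ hp
  constructor
  · obtain ⟨d, hd, hd1⟩ := exists_between hlt
    obtain ⟨A, hA, hμA, hdim⟩ := MarkovGeometric.exists_measurableSet_dimH_le hβ₀ hβ₁ hp hd
    refine ⟨Aᶜ, hA.compl, (prob_compl_eq_zero_iff hA).2 hμA, ?_⟩
    -- Lebesgue measure is one-dimensional Hausdorff measure, which vanishes on sets of dimension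
    -- below one.
    rw [compl_compl, ← hausdorffMeasure_real]
    have hA1 : dimH A < ((1 : NNReal) : ENNReal) :=
      hdim.trans_lt (by rw [ENNReal.coe_one, ENNReal.ofReal_lt_one]; exact hd1)
    simpa using hausdorffMeasure_of_dimH_lt hA1
  · unfold MarkovGeometric.dimHMeasure
    -- The set of full measure depends on `d`, so the bound is obtained for each `d` above the
    -- quotient and passed to the limit.
    refine ge_of_tendsto ((ENNReal.continuous_ofReal.tendsto _).mono_left
      (nhdsWithin_le_nhds (s := Set.Ioi ((p * Real.log p + (1 - p) * Real.log (1 - p)) /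
        (Real.log β₀ + (1 - p) * Real.log β₁))))) ?_
    filter_upwards [self_mem_nhdsWithin] with d hd
    obtain ⟨A, hA, hμA, hdim⟩ := MarkovGeometric.exists_measurableSet_dimH_le hβ₀ hβ₁ hp hd
    exact le_trans (sInf_le ⟨A, hA, hμA, rfl⟩) hdim
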